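/- **Corollary 6.2.** Let $\eta_0,\eta_1,\dotsc$ be independent standard complex normal random variables on a probability space, that is, each has density $\frac1\pi e^{-|w|^2}$ on $\mathbb{C}$ (so $\mathbb{E}[\eta_j]=0$ and $\mathbb{E}[|\eta_j|^2]=1$). Let $\varphi_j(z)=z^j$, let $v\in\mathbb{C}$, and put $\Phi_n(z)=\sum_{j=0}^n\eta_j\varphi_j(z)$. For $0<\varrho<1$ let $D_\varrho=\{z\in\mathbb{C}:|z|<\varrho\}$, and let $N_{D_\varrho}^{\Phi_n,v}$ be the number of roots, counted with multiplicity, of the equation $\Phi_n(z)=v$ in $D_\varrho$. For nonnegative integers $k,l$ let $K_n^{(k,l)}(z,w)=\sum_{j=0}^n\varphi_j^{(k)}(z)\,\overline{\varphi_j^{(l)}(w)}$, let $K_n=K_n^{(0,0)}$, and define $$\rho_{n,v}(z)=\frac1\pi\left[\frac{K_n^{(1,1)}(z,z)}{K_n(z,z)}-\frac{|K_n^{(0,1)}(z,z)|^2}{K_n(z,z)^2}\left(1-\frac{|v|^2}{K_n(z,z)}\right)\right]\exp\left(-\frac{|v|^2}{K_n(z,z)}\right).$$ Then, for every $v\in\mathbb{C}$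 and every $0<\varrho<1$, each $N_{D_\varrho}^{\Phi_n,v}$ is integrable, $$\lim_{n\to\infty}\mathbb{E}\bigl[N_{D_\varrho}^{\Phi_n,v}\bigr]=\frac{\varrho^2}{1-\varrho^2}\exp\bigl[-|v|^2(1-\varrho^2)\bigr],$$ and, for every $z\in\mathbb{C}$ with $|z|<1$, $$\lim_{n\to\infty}\frac{\rho_{n,v}(z)}{\mathbb{E}\bigl[N_{D_\varrho}^{\Phi_n,v}\bigr]}=\frac{1-\varrho^2}{\pi\varrho^2}\left(\frac1{(1-|z|^2)^2}+\frac{|vz|^2}{1-|z|^2}\right)\exp\bigl[|v|^2(|z|^2-\varrho^2)\bigr].$$ -/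

import Mathlib

open MeasureTheory ProbabilityTheory Filter Topology

noncomputable section

namespace RandomPolynomial

/-- The standard complex normal law: density `π⁻¹ exp (-|z|²)` with respect to Lebesgue measure
on `ℂ` (so the mean is `0` and the variance `E[η * conj η]` is `1`). -/
def stdComplexNormal : Measure ℂ :=
  volume.withDensity fun z => ENNReal.ofReal (1 / Real.pi * Real.exp (-‖z‖ ^ 2))

/-- The polynomial `Φ_n = ∑_{j=0}^n c_j φ_j` with basis `φ` and coefficients `c`. -/
def randomPoly (φ : ℕ → Polynomial ℂ) (n : ℕ) (c : ℕ → ℂ) : Polynomial ℂ :=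
  ∑ j ∈ Finset.range (n + 1), Polynomial.C (c j) * φ j

open Classical in
/-- The number of roots in `Θ`, with multiplicity, of the equation `p(z) = v`.
(If `p` is the constant `v`, then Mathlib's convention gives the value `0`.) -/
def rootCount (p : Polynomial ℂ) (v : ℂ) (Θ : Set ℂ) : ℕ :=
  ((p - Polynomial.C v).roots.filter fun z => z ∈ Θ).card

/-- The differentiated reproducing kernel
`K_n^{(k,l)}(z,w) = ∑_{j=0}^n φ_j^{(k)}(z) * conj (φ_j^{(l)}(w))`. -/
def kernel (φ : ℕ → Polynomial ℂ) (n k l : ℕ) (z w : ℂ) : ℂ :=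
  ∑ j ∈ Finset.range (n + 1),
    (Polynomial.derivative^[k] (φ j)).eval z *
      (starRingEnd ℂ) ((Polynomial.derivative^[l] (φ j)).eval w)

/-- The density `ρ_{n,v}(z)` of the roots of `Φ_n = v`:
`(1/π) [K¹¹/K - |K⁰¹|²/K² (1 - |v|²/K)] exp (-|v|²/K)`, with all kernels evaluated at `(z,z)`.
The values `K = K_n^{(0,0)}(z,z)` and `K¹¹ = K_n^{(1,1)}(z,z)` are sums of squared moduli,
hence real, and are read off as real parts. -/
def density (φ : ℕ → Polynomial ℂ) (n : ℕ) (v z : ℂ) : ℝ :=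
  1 / Real.pi *
    ((kernel φ n 1 1 z z).re / (kernel φ n 0 0 z z).re
      - ‖kernel φ n 0 1 z z‖ ^ 2 / (kernel φ n 0 0 z z).re ^ 2
        * (1 - ‖v‖ ^ 2 / (kernel φ n 0 0 z z).re))
    * Real.exp (-(‖v‖ ^ 2 / (kernel φ n 0 0 z z).re))

end RandomPolynomial

end

namespace RandomPolynomial

/-! By Jensen's formula, the increase of the circle mean of `log ‖p - v‖` from radius `r` to `R`
lies between `log (R / r)` times the root count in the smaller disc and the same multiple of the
count in the larger one (`rootCount_le_logMean_sub`, `logMean_sub_le_rootCount`). For `p = Φ_n`, the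
value at any point of the circle of radius `R` is a centred complex normal of variance `K = ∑ R ^ (2
* j)`, so the expected circle mean is `meanLog K v`. Rotation invariance and Jensen in degree one
turn this into the expectation of `log (max (√K * ‖η‖) ‖v‖)`, whose increments in `K` are bounded on
both sides by the tail `exp (-‖v‖ ^ 2 / K)` times half the increment of `log K`. Letting the two
radii merge gives the exact expected count for every `n` (`integral_rootCount_randomPoly`). The
limits are then geometric series; the density is treated as an explicit function of the kernels. -/

/-! ### Jensen's formula as a two-sided bound on root counts -/

/-- Truncation at `s` can only shrink the increment of the logarithm. This bound and its companion
serve twice: for roots (`t = 1`, `s` the modulus of a root) and for Gaussian values (`t = ‖x‖`, `s =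
‖v‖`). -/
theorem log_max_mul_sub_log_max_mul_le {a b t s : ℝ} (ha : 0 < a) (hab : a ≤ b) (ht : 0 ≤ t)
    (hs : 0 ≤ s) :
    Real.log (max (b * t) s) - Real.log (max (a * t) s) ≤
      if s < b * t then Real.log (b / a) else 0 := by
  have hmul : a * t ≤ b * t := by gcongr
  split_ifs with h
  · have hbt : 0 < b * t := hs.trans_lt h
    have htpos : 0 < t := pos_of_mul_pos_right hbt (ha.le.trans hab)
    rw [max_eq_left h.le, ← Real.log_div hbt.ne' (by positivity)]
    have hb : 0 < b := ha.trans_le hab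
    refine Real.log_le_log (by positivity) ?_
    rw [div_le_div_iff₀ (by positivity) ha]
    calc b * t * a = b * (a * t) := by ring
      _ ≤ b * max (a * t) s := by gcongr; exact le_max_left _ _
  · rw [max_eq_right (not_lt.1 h), max_eq_right (hmul.trans (not_lt.1 h)), sub_self]

theorem le_log_max_mul_sub_log_max_mul {a b t s : ℝ} (ha : 0 < a) (hab : a ≤ b) (ht : 0 ≤ t)
    (hs : 0 ≤ s) :
    (if s < a * t then Real.log (b / a) else 0) ≤
      Real.log (max (b * t) s) - Real.log (max (a * t) s) := by
  have hmul : a * t ≤ b * t := by gcongr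
  split_ifs with h
  · have hat : 0 < a * t := hs.trans_lt h
    have htpos : 0 < t := pos_of_mul_pos_right hat ha.le
    rw [max_eq_left h.le, max_eq_left (h.le.trans hmul),
      ← Real.log_div (hat.trans_le hmul).ne' hat.ne', mul_div_mul_right _ _ htpos.ne']
  · rw [sub_nonneg, max_eq_right (not_lt.1 h)]
    -- If `s = 0` then `t = 0`, and both logarithms are `log 0 = 0`.
    rcases hs.eq_or_lt with rfl | hs'
    · have : t = 0 := by
        by_contra h0
        exact h (mul_pos ha (ht.lt_of_ne' h0))
      simp [this]
    · exact Real.log_le_log hs' (le_max_right _ _)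

/-- The mean of `log ‖p‖` over the circle of radius `R` about `0`. -/
noncomputable def logMean (p : Polynomial ℂ) (R : ℝ) : ℝ :=
  (2 * Real.pi)⁻¹ * ∫ θ in (0)..(2 * Real.pi), Real.log ‖p.eval (circleMap 0 R θ)‖

theorem logMean_eq_logMahlerMeasure (p : Polynomial ℂ) (R : ℝ) :
    logMean p R = (p.comp (Polynomial.C (R : ℂ) * Polynomial.X)).logMahlerMeasure := by
  simp [logMean, Polynomial.logMahlerMeasure_def, Real.circleAverage_def, circleMap]

/-- Rescaling by `R` reduces to the Mahler measure on the unit circle. The leading coefficient gains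
one factor `R` per root, which turns `max 1 (‖a‖ / R)` into `max R ‖a‖`. -/
theorem logMean_eq {p : Polynomial ℂ} (hp : p ≠ 0) {R : ℝ} (hR : 0 < R) :
    logMean p R =
      Real.log ‖p.leadingCoeff‖ + (p.roots.map fun a => Real.log (max R ‖a‖)).sum := by
  have hR' : (R : ℂ) ≠ 0 := by exact_mod_cast hR.ne'
  have hroots : (p.comp (Polynomial.C (R : ℂ) * Polynomial.X)).roots
      = p.roots.map fun a => (R : ℂ)⁻¹ * a := by
    have := Polynomial.roots_comp_C_mul_X_add_C p (R : ℂ) 0 (isUnit_iff_ne_zero.2 hR')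
    simpa [Ring.inverse_eq_inv'] using this
  have hlead : (p.comp (Polynomial.C (R : ℂ) * Polynomial.X)).leadingCoeff
      = p.leadingCoeff * (R : ℂ) ^ p.natDegree := by
    rw [Polynomial.leadingCoeff_comp (by simp [Polynomial.natDegree_C_mul_X _ hR'])]
    simp
  rw [logMean_eq_logMahlerMeasure,
    Polynomial.logMahlerMeasure_eq_log_leadingCoeff_add_sum_log_roots, hroots, hlead, norm_mul,
    Real.log_mul (by simpa using hp) (norm_ne_zero_iff.2 (pow_ne_zero _ hR'))]
  have hsum : Real.log ‖(R : ℂ) ^ p.natDegree‖ = (p.roots.map fun _ => Real.log R).sum := by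
    simp [(IsAlgClosed.splits p).natDegree_eq_card_roots, abs_of_pos hR]
  rw [hsum, add_assoc, Multiset.map_map, ← Multiset.sum_map_add]
  congr 3
  ext a
  have : max 1 (R⁻¹ * ‖a‖) = R⁻¹ * max R ‖a‖ := by
    rw [mul_max_of_nonneg _ _ (by positivity), inv_mul_cancel₀ hR.ne']
  simp only [Function.comp, norm_mul, norm_inv, Complex.norm_real, Real.norm_eq_abs,
    abs_of_pos hR]
  rw [Real.posLog_eq_log_max_one (by positivity), this,
    Real.log_mul (by positivity) (by positivity), Real.log_inv]
  ring

theorem card_filter_eq_sum_ite {α : Type*} (s : Multiset α) (p : α → Prop) [DecidablePred p]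
    (c : ℝ) : ((s.filter p).card : ℝ) * c = (s.map fun a => if p a then c else 0).sum := by
  induction s using Multiset.induction_on with
  | empty => simp
  | cons a s ih =>
    by_cases h : p a
    · simp [h, ← ih, add_mul, add_comm]
    · simp [h, ← ih]

theorem logMean_sub_le_rootCount (p : Polynomial ℂ) (v : ℂ) {r R : ℝ} (hr : 0 < r)
    (hrR : r ≤ R) :
    logMean (p - Polynomial.C v) R - logMean (p - Polynomial.C v) r ≤
      rootCount p v (Metric.ball 0 R) * Real.log (R / r) := by
  classical
  rcases eq_or_ne (p - Polynomial.C v) 0 with h | h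
  -- For `p = v` everything vanishes: the zero polynomial has no roots by convention, and `log 0 =
  -- 0`.
  · simp [rootCount, h, logMean]
  rw [rootCount, card_filter_eq_sum_ite, logMean_eq h hr, logMean_eq h (hr.trans_le hrR),
    add_sub_add_left_eq_sub, ← Multiset.sum_map_sub]
  refine Multiset.sum_map_le_sum_map _ _ fun a _ => ?_
  simpa using log_max_mul_sub_log_max_mul_le hr hrR zero_le_one (norm_nonneg a)

theorem rootCount_le_logMean_sub (p : Polynomial ℂ) (v : ℂ) {r R : ℝ} (hr : 0 < r)
    (hrR : r ≤ R) :
    rootCount p v (Metric.ball 0 r) * Real.log (R / r) ≤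
      logMean (p - Polynomial.C v) R - logMean (p - Polynomial.C v) r := by
  classical
  rcases eq_or_ne (p - Polynomial.C v) 0 with h | h
  · simp [rootCount, h, logMean]
  rw [rootCount, card_filter_eq_sum_ite, logMean_eq h hr, logMean_eq h (hr.trans_le hrR),
    add_sub_add_left_eq_sub, ← Multiset.sum_map_sub]
  refine Multiset.sum_map_le_sum_map _ _ fun a _ => ?_
  simpa using le_log_max_mul_sub_log_max_mul hr hrR zero_le_one (norm_nonneg a)

/-- The number of roots in an open disc is attained by slightly smaller discs. -/
theorem eventually_rootCount_ball_eq (p : Polynomial ℂ) (v : ℂ) (R : ℝ) :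
    ∀ᶠ r in 𝓝[<] R, rootCount p v (Metric.ball 0 r) = rootCount p v (Metric.ball 0 R) := by
  classical
  have key : ∀ s : Multiset ℂ, ∀ᶠ r in 𝓝[<] R,
      s.filter (fun z => z ∈ Metric.ball (0 : ℂ) r) =
        s.filter (fun z => z ∈ Metric.ball (0 : ℂ) R) := by
    intro s
    have : ∀ a ∈ s.toFinset, ∀ᶠ r in 𝓝[<] R, (a ∈ Metric.ball (0 : ℂ) r ↔ a ∈ Metric.ball 0 R) := by
      intro a _
      by_cases ha : ‖a‖ < R
      · filter_upwards [Ioo_mem_nhdsLT ha] with r hr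
        simp [ha, hr.1]
      · filter_upwards [self_mem_nhdsWithin] with r hr
        simp [ha, (show r < R from hr).le.trans (not_lt.1 ha)]
    filter_upwards [(Filter.eventually_all_finset _).2 this] with r hr
    exact Multiset.filter_congr fun a ha => hr a (Multiset.mem_toFinset.2 ha)
  filter_upwards [key (p - Polynomial.C v).roots] with r hr
  rw [rootCount, rootCount, hr]

/-- Jensen's formula in differentiated form. -/
theorem tendsto_logMean_sub_div (p : Polynomial ℂ) (v : ℂ) {R : ℝ} (hR : 0 < R) :
    Tendsto (fun r => (logMean (p - Polynomial.C v) R - logMean (p - Polynomial.C v) r) /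
      Real.log (R / r)) (𝓝[<] R) (𝓝 (rootCount p v (Metric.ball 0 R) : ℝ)) := by
  -- For `r` just below `R` the two counts agree, so the two bounds pin the quotient: it is
  -- eventually constant.
  refine tendsto_const_nhds.congr' ?_
  filter_upwards [eventually_rootCount_ball_eq p v R, Ioo_mem_nhdsLT hR] with r h hr
  have hlog : 0 < Real.log (R / r) := Real.log_pos ((one_lt_div hr.1).2 hr.2)
  have h1 := logMean_sub_le_rootCount p v hr.1 hr.2.le
  have h2 := rootCount_le_logMean_sub p v hr.1 hr.2.le
  rw [h] at h2
  rw [eq_div_iff hlog.ne']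
  exact le_antisymm h2 h1

theorem rootCount_randomPoly_le {φ : ℕ → Polynomial ℂ} (hφ : ∀ j, φ j = Polynomial.X ^ j) (n : ℕ)
    (c : ℕ → ℂ) (v : ℂ) (Θ : Set ℂ) : rootCount (randomPoly φ n c) v Θ ≤ n := by
  classical
  refine (Multiset.card_le_card (Multiset.filter_le _ _)).trans
    ((Polynomial.card_roots' _).trans ?_)
  refine (Polynomial.natDegree_sub_C).le.trans ?_
  refine Polynomial.natDegree_sum_le_of_forall_le _ _ fun j hj => ?_
  rw [hφ]
  exact (Polynomial.natDegree_C_mul_X_pow_le _ _).trans (Nat.lt_succ_iff.1 (Finset.mem_range.1 hj))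

/-! ### Complex normal laws -/

/-- The law of `√K * η` for a standard complex normal `η`. -/
noncomputable def complexNormal (K : ℝ) : Measure ℂ :=
  stdComplexNormal.map fun x => (√K : ℂ) * x

theorem charFun_stdComplexNormal (t : ℂ) :
    charFun stdComplexNormal t = Complex.exp (-(‖t‖ ^ 2 / 4 : ℝ)) := by
  rw [charFun_apply, stdComplexNormal, integral_withDensity_eq_integral_toReal_smul
    (by fun_prop) (by simp)]
  have h : ∀ x : ℂ, (ENNReal.ofReal (1 / Real.pi * Real.exp (-‖x‖ ^ 2))).toReal •
      Complex.exp (inner ℝ x t * Complex.I) = (Real.pi : ℂ)⁻¹ *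
        Complex.exp (-1 * ‖x‖ ^ 2 + Complex.I * inner ℝ t x) := by
    intro x
    rw [ENNReal.toReal_ofReal (by positivity), real_inner_comm, Complex.exp_add]
    simp only [Complex.real_smul]
    push_cast
    rw [mul_comm Complex.I]
    ring_nf
  simp_rw [h]
  rw [integral_const_mul, GaussianFourier.integral_cexp_neg_mul_sq_norm_add (by simp)]
  have hpi : (Real.pi : ℂ) ≠ 0 := by exact_mod_cast Real.pi_ne_zero
  simp [hpi]
  ring_nf

theorem integrable_exp_neg_mul_sq_norm {b : ℝ} (hb : 0 < b) :
    Integrable (fun x : ℂ => Real.exp (-b * ‖x‖ ^ 2)) := by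
  have := (GaussianFourier.integrable_cexp_neg_mul_sq_norm_add (V := ℂ) (b := (b : ℂ))
    (by simpa using hb) 0 0).norm
  simpa [Complex.norm_exp, ← Complex.ofReal_pow] using this

instance : IsProbabilityMeasure stdComplexNormal := by
  have hfin : IsFiniteMeasure stdComplexNormal := by
    refine isFiniteMeasure_withDensity_ofReal ?_
    simpa using ((integrable_exp_neg_mul_sq_norm one_pos).const_mul (1 / Real.pi)).2
  -- The total mass is the characteristic function at `0`.
  have h := charFun_stdComplexNormal 0
  rw [charFun_zero] at h
  refine ⟨?_⟩
  have h1 : stdComplexNormal.real Set.univ = 1 := by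
    have : ((stdComplexNormal.real Set.univ : ℝ) : ℂ) = ((1 : ℝ) : ℂ) := by simpa using h
    exact_mod_cast this
  rwa [measureReal_def, ENNReal.toReal_eq_one_iff] at h1

theorem charFun_map_mul_stdComplexNormal (w t : ℂ) :
    charFun (stdComplexNormal.map fun x => w * x) t
      = Complex.exp (-(‖w‖ ^ 2 * ‖t‖ ^ 2 / 4 : ℝ)) := by
  have h : charFun (stdComplexNormal.map fun x => w * x) t
      = charFun stdComplexNormal (starRingEnd ℂ w * t) := by
    rw [charFun_apply, charFun_apply, integral_map (by fun_prop) (by fun_prop)]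
    congr with x
    congr 3
    simp only [Complex.inner, map_mul]
    ring_nf
  rw [h, charFun_stdComplexNormal]
  simp [mul_pow]

instance (K : ℝ) : IsProbabilityMeasure (complexNormal K) :=
  Measure.isProbabilityMeasure_map (by fun_prop)

theorem charFun_complexNormal {K : ℝ} (hK : 0 ≤ K) (t : ℂ) :
    charFun (complexNormal K) t = Complex.exp (-(K * ‖t‖ ^ 2 / 4 : ℝ)) := by
  rw [complexNormal, charFun_map_mul_stdComplexNormal]
  simp [abs_of_nonneg (Real.sqrt_nonneg K), Real.sq_sqrt hK]

/-- Rotation invariance: the characteristic function sees `w` only through its modulus. -/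
theorem map_mul_stdComplexNormal (w : ℂ) :
    stdComplexNormal.map (fun x => w * x) = complexNormal (‖w‖ ^ 2) := by
  have : IsProbabilityMeasure (stdComplexNormal.map fun x => w * x) :=
    Measure.isProbabilityMeasure_map (by fun_prop)
  refine Measure.ext_of_charFun (funext fun t => ?_)
  rw [charFun_map_mul_stdComplexNormal, charFun_complexNormal (by positivity)]

/-- A linear combination of independent standard complex normals is complex normal. -/
theorem hasLaw_sum_mul {Ω : Type*} [MeasurableSpace Ω] {P : Measure Ω} [IsProbabilityMeasure P]
    {ι : Type*} {η : ι → Ω → ℂ} (hη_indep : iIndepFun η P)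
    (hη_law : ∀ j, HasLaw (η j) stdComplexNormal P) (s : Finset ι) (w : ι → ℂ) :
    HasLaw (fun ω => ∑ j ∈ s, w j * η j ω) (complexNormal (∑ j ∈ s, ‖w j‖ ^ 2)) P := by
  have hm : ∀ j, AEMeasurable (fun ω => w j * η j ω) P :=
    fun j => (hη_law j).aemeasurable.const_mul _
  have hsum : AEMeasurable (fun ω => ∑ j ∈ s, w j * η j ω) P :=
    Finset.aemeasurable_fun_sum _ fun j _ => hm j
  refine ⟨hsum, ?_⟩
  have : IsProbabilityMeasure (P.map fun ω => ∑ j ∈ s, w j * η j ω) :=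
    Measure.isProbabilityMeasure_map hsum
  refine Measure.ext_of_charFun (funext fun t => ?_)
  have hind : iIndepFun (fun j ω => w j * η j ω) P :=
    hη_indep.comp (fun j x => w j * x) fun j => by fun_prop
  have hlaw : ∀ j, P.map (fun ω => w j * η j ω) = complexNormal (‖w j‖ ^ 2) := by
    intro j
    rw [← map_mul_stdComplexNormal, ← (hη_law j).map_eq,
      AEMeasurable.map_map_of_aemeasurable (by fun_prop) (hη_law j).aemeasurable]
    rfl
  rw [iIndepFun.charFun_map_fun_finsetSum_eq_prod (fun j _ => hm j) (hind.restrict _),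
    Finset.prod_apply, charFun_complexNormal (by positivity)]
  simp_rw [hlaw]
  rw [Finset.prod_congr rfl fun j _ => charFun_complexNormal (by positivity) t, ← Complex.exp_sum]
  congr 1
  push_cast
  rw [Finset.sum_neg_distrib, Finset.sum_mul, Finset.sum_div]

/-! ### Integrability of the logarithm and the Gaussian tail -/

/-- In polar coordinates the Jacobian `y` cancels the singularity `y⁻¹`. -/
theorem integrable_indicator_ball_inv_norm :
    Integrable fun x : ℂ => (Set.Iio (1 : ℝ)).indicator (fun y => y⁻¹) ‖x‖ := by
  rw [integrable_fun_norm_addHaar volume (f := (Set.Iio (1 : ℝ)).indicator fun y => y⁻¹)]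
  have h : IntegrableOn ((Set.Ioo (0 : ℝ) 1).indicator fun _ => (1 : ℝ)) (Set.Ioi 0) := by
    refine Integrable.integrableOn ?_
    rw [integrable_indicator_iff measurableSet_Ioo]
    simp
  refine h.congr_fun (fun y hy => ?_) measurableSet_Ioi
  have hy : 0 < y := hy
  by_cases h1 : y < 1 <;> simp [h1, hy, hy.ne']

theorem abs_log_le_add_indicator {t : ℝ} (ht : 0 ≤ t) :
    |Real.log t| ≤ t + (Set.Iio (1 : ℝ)).indicator (fun y => y⁻¹) t := by
  rcases ht.eq_or_lt with rfl | ht'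
  · simp
  by_cases h : t < 1
  · rw [Set.indicator_of_mem (by exact h), abs_of_nonpos (Real.log_nonpos ht h.le),
      ← Real.log_inv]
    exact (Real.log_le_self (inv_nonneg.2 ht)).trans (by linarith)
  · rw [Set.indicator_of_notMem (by exact h), abs_of_nonneg (Real.log_nonneg (not_lt.1 h)),
      add_zero]
    exact Real.log_le_self ht

/-- The growth of the logarithm is at most linear and is absorbed by the Gaussian; its singularity
at `u` is dominated by the locally integrable `‖x - u‖⁻¹`. -/
theorem integrable_log_norm_sub_stdComplexNormal (u : ℂ) :
    Integrable (fun x => Real.log ‖x - u‖) stdComplexNormal := by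
  rw [stdComplexNormal, integrable_withDensity_iff_integrable_smul' (by fun_prop) (by simp)]
  have hdom : Integrable fun x : ℂ => Real.exp (-(1 / 2) * ‖x‖ ^ 2)
      + ‖u‖ * Real.exp (-1 * ‖x‖ ^ 2)
      + (Set.Iio (1 : ℝ)).indicator (fun y => y⁻¹) ‖x - u‖ :=
    ((integrable_exp_neg_mul_sq_norm (by norm_num)).add
      ((integrable_exp_neg_mul_sq_norm one_pos).const_mul _)).add
      (integrable_indicator_ball_inv_norm.comp_sub_right u)
  refine hdom.mono' (by fun_prop) (ae_of_all _ fun x => ?_)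
  rw [ENNReal.toReal_ofReal (by positivity), smul_eq_mul, norm_mul, Real.norm_eq_abs,
    Real.norm_eq_abs, abs_of_nonneg (by positivity)]
  have hpi : 1 / Real.pi ≤ 1 := by
    rw [div_le_one Real.pi_pos]; linarith [Real.pi_gt_three]
  have hind : 0 ≤ (Set.Iio (1 : ℝ)).indicator (fun y => y⁻¹) ‖x - u‖ :=
    Set.indicator_apply_nonneg fun _ => by positivity
  -- Half of the Gaussian exponent is spent on the factor `‖x‖`.
  have hexp : ‖x‖ * Real.exp (-‖x‖ ^ 2) ≤ Real.exp (-(1 / 2) * ‖x‖ ^ 2) := by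
    have h1 : ‖x‖ ≤ Real.exp (1 / 2 * ‖x‖ ^ 2) := by
      nlinarith [Real.add_one_le_exp (1 / 2 * ‖x‖ ^ 2), sq_nonneg (‖x‖ - 1)]
    calc ‖x‖ * Real.exp (-‖x‖ ^ 2)
        ≤ Real.exp (1 / 2 * ‖x‖ ^ 2) * Real.exp (-‖x‖ ^ 2) := by gcongr
      _ = Real.exp (-(1 / 2) * ‖x‖ ^ 2) := by rw [← Real.exp_add]; congr 1; ring
  have hone : Real.exp (-‖x‖ ^ 2) ≤ 1 := Real.exp_le_one_iff.2 (by simp)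
  calc 1 / Real.pi * Real.exp (-‖x‖ ^ 2) * |Real.log ‖x - u‖|
      ≤ 1 * Real.exp (-‖x‖ ^ 2) * ((‖x‖ + ‖u‖) +
          (Set.Iio (1 : ℝ)).indicator (fun y => y⁻¹) ‖x - u‖) := by
        gcongr
        exact (abs_log_le_add_indicator (norm_nonneg _)).trans (by gcongr; exact norm_sub_le _ _)
    _ = ‖x‖ * Real.exp (-‖x‖ ^ 2) + ‖u‖ * Real.exp (-1 * ‖x‖ ^ 2) + Real.exp (-‖x‖ ^ 2) *
          (Set.Iio (1 : ℝ)).indicator (fun y => y⁻¹) ‖x - u‖ := by ring_nf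
    _ ≤ _ := by
        gcongr
        exact mul_le_of_le_one_left hind hone

theorem integrable_log_norm_sub_complexNormal {K : ℝ} (hK : 0 < K) (v : ℂ) :
    Integrable (fun x => Real.log ‖x - v‖) (complexNormal K) := by
  rw [complexNormal, integrable_map_measure (Measurable.aestronglyMeasurable (by fun_prop))
    (by fun_prop)]
  have hs : (√K : ℂ) ≠ 0 := by simpa using (Real.sqrt_pos.2 hK).ne'
  have h := (integrable_log_norm_sub_stdComplexNormal (v / √K)).abs.add
    (integrable_const |Real.log √K|)
  refine h.mono' (Measurable.aestronglyMeasurable (by fun_prop)) (ae_of_all _ fun x => ?_)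
  have heq : ‖(√K : ℂ) * x - v‖ = √K * ‖x - v / √K‖ := by
    rw [← abs_of_nonneg (Real.sqrt_nonneg K), ← Real.norm_eq_abs, ← Complex.norm_real,
      ← norm_mul, mul_sub]
    simp [mul_div_cancel₀ _ hs, abs_of_nonneg (Real.sqrt_nonneg K)]
  simp only [Function.comp, heq, Real.norm_eq_abs, Pi.add_apply]
  rcases (norm_nonneg (x - v / √K)).eq_or_lt with h0 | h0
  · rw [← h0]; simp
  · rw [Real.log_mul (Real.sqrt_pos.2 hK).ne' h0.ne', add_comm]
    exact abs_add_le _ _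

/-- In polar coordinates the radial density has an explicit antiderivative. This tail is the source
of the exponential factor in the expected count. -/
theorem measureReal_lt_norm_stdComplexNormal {a : ℝ} (ha : 0 ≤ a) :
    stdComplexNormal.real {x | a < ‖x‖} = Real.exp (-a ^ 2) := by
  have hset : MeasurableSet {x : ℂ | a < ‖x‖} := measurableSet_lt (by fun_prop) (by fun_prop)
  rw [← integral_indicator_one hset, stdComplexNormal,
    integral_withDensity_eq_integral_toReal_smul (by fun_prop) (by simp)]
  have h : ∀ x : ℂ, (ENNReal.ofReal (1 / Real.pi * Real.exp (-‖x‖ ^ 2))).toReal •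
      {x : ℂ | a < ‖x‖}.indicator (1 : ℂ → ℝ) x =
        (Set.Ioi a).indicator (fun y => 1 / Real.pi * Real.exp (-y ^ 2)) ‖x‖ := by
    intro x
    rw [ENNReal.toReal_ofReal (by positivity)]
    by_cases hx : a < ‖x‖ <;> simp [hx]
  simp_rw [h]
  rw [integral_fun_norm_addHaar volume
    ((Set.Ioi a).indicator fun y => 1 / Real.pi * Real.exp (-y ^ 2))]
  have hint : ∫ y in Set.Ioi (0 : ℝ), y ^ (Module.finrank ℝ ℂ - 1) •
      (Set.Ioi a).indicator (fun y => 1 / Real.pi * Real.exp (-y ^ 2)) y =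
      ∫ y in Set.Ioi a, y * (1 / Real.pi * Real.exp (-y ^ 2)) := by
    have : ∀ y : ℝ, y ^ (Module.finrank ℝ ℂ - 1) •
        (Set.Ioi a).indicator (fun y => 1 / Real.pi * Real.exp (-y ^ 2)) y =
        (Set.Ioi a).indicator (fun y => y * (1 / Real.pi * Real.exp (-y ^ 2))) y := by
      intro y
      by_cases hy : a < y <;> simp [hy]
    simp_rw [this]
    rw [setIntegral_indicator measurableSet_Ioi, Set.inter_eq_right.2 (Set.Ioi_subset_Ioi ha)]
  have hderiv : ∀ y ∈ Set.Ici a, HasDerivAt (fun y => -(1 / (2 * Real.pi)) * Real.exp (-y ^ 2))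
      (y * (1 / Real.pi * Real.exp (-y ^ 2))) y := by
    intro y _
    refine ((hasDerivAt_pow 2 y).fun_neg.exp.const_mul (-(1 / (2 * Real.pi)))).congr_deriv ?_
    push_cast
    field_simp
  have hlim : Tendsto (fun y : ℝ => -(1 / (2 * Real.pi)) * Real.exp (-y ^ 2)) atTop
      (𝓝 (-(1 / (2 * Real.pi)) * 0)) := by
    refine Tendsto.const_mul _ (Real.tendsto_exp_atBot.comp ?_)
    exact tendsto_neg_atTop_atBot.comp (tendsto_pow_atTop two_ne_zero)
  rw [hint, integral_Ioi_of_hasDerivAt_of_nonneg' hderiv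
    (fun y hy => mul_nonneg (ha.trans hy.le) (by positivity)) hlim]
  have hball : (volume : Measure ℂ).real (Metric.ball 0 1) = Real.pi := by
    simp [measureReal_def, Complex.volume_ball]
  rw [hball]
  simp
  field_simp

/-! ### Circle averages and the expected logarithm -/

/-- Fubini for a family of random variables on an interval of angles, all with the same law. -/
theorem integral_circle_comp_hasLaw {Ω : Type*} [MeasurableSpace Ω] {P : Measure Ω}
    [IsProbabilityMeasure P] {μ : Measure ℂ} {F : ℝ → Ω → ℂ}
    (hF : AEMeasurable (fun q : Ω × ℝ => F q.2 q.1)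
      (P.prod (volume.restrict (Set.Ioc 0 (2 * Real.pi)))))
    (hlaw : ∀ θ, HasLaw (F θ) μ P) {g : ℂ → ℝ} (hgm : Measurable g) (hg : Integrable g μ) :
    Integrable (fun ω => ∫ θ in (0)..(2 * Real.pi), g (F θ ω)) P ∧
      ∫ ω, (∫ θ in (0)..(2 * Real.pi), g (F θ ω)) ∂P = 2 * Real.pi * ∫ x, g x ∂μ := by
  have hpi : (0 : ℝ) ≤ 2 * Real.pi := by positivity
  have hcomp : ∀ f : ℂ → ℝ, Measurable f → ∀ θ, ∫ ω, f (F θ ω) ∂P = ∫ x, f x ∂μ := by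
    intro f hf θ
    rw [← (hlaw θ).map_eq, integral_map (hlaw θ).aemeasurable hf.aestronglyMeasurable]
  have hint : Integrable (fun q : Ω × ℝ => g (F q.2 q.1))
      (P.prod (volume.restrict (Set.Ioc 0 (2 * Real.pi)))) := by
    rw [integrable_prod_iff' (by exact (hgm.comp_aemeasurable hF).aestronglyMeasurable)]
    refine ⟨ae_of_all _ fun θ => ?_, ?_⟩
    · have := hg
      rw [← (hlaw θ).map_eq, integrable_map_measure hgm.aestronglyMeasurable
        (hlaw θ).aemeasurable] at this
      exact this
    · simp only [hcomp (fun x => ‖g x‖) hgm.norm]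
      exact integrable_const _
  simp_rw [intervalIntegral.integral_of_le hpi]
  refine ⟨hint.integral_prod_left, ?_⟩
  rw [integral_integral_swap hint]
  simp_rw [hcomp g hgm]
  rw [setIntegral_const]
  simp [measureReal_def, Real.pi_nonneg]

/-- The expectation of `log ‖√K * η - v‖` for a standard complex normal `η`. -/
noncomputable def meanLog (K : ℝ) (v : ℂ) : ℝ :=
  ∫ x, Real.log ‖x - v‖ ∂(complexNormal K)

theorem logMean_C_mul_X_sub_C (a v : ℂ) :
    logMean (Polynomial.C a * Polynomial.X - Polynomial.C v) 1 = Real.log (max ‖a‖ ‖v‖) := by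
  rw [logMean_eq_logMahlerMeasure]
  rcases eq_or_ne a 0 with rfl | ha
  · rw [map_zero, zero_mul, zero_sub, ← map_neg]
    rw [Polynomial.C_comp, Polynomial.logMahlerMeasure_const, norm_neg, norm_zero,
      max_eq_right (norm_nonneg v)]
  · rw [Polynomial.logMahlerMeasure_eq_log_MahlerMeasure]
    have := Polynomial.mahlerMeasure_C_mul_X_add_C ha (-v)
    simp only [map_neg, ← sub_eq_add_neg, norm_neg] at this
    simp [this]

/-- Multiplying `√K * x` by a point of the unit circle preserves its law. Averaging over that point
and applying Jensen to a linear polynomial replaces `log ‖x - v‖` by a truncated logarithm. -/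
theorem meanLog_eq_integral_log_max {K : ℝ} (hK : 0 < K) (v : ℂ) :
    Integrable (fun x : ℂ => Real.log (max (√K * ‖x‖) ‖v‖)) stdComplexNormal ∧
      ∫ x : ℂ, Real.log (max (√K * ‖x‖) ‖v‖) ∂stdComplexNormal = meanLog K v := by
  have hlaw : ∀ θ, HasLaw (fun x : ℂ => (√K * circleMap 0 1 θ) * x) (complexNormal K)
      stdComplexNormal := by
    intro θ
    refine ⟨by fun_prop, ?_⟩
    rw [map_mul_stdComplexNormal]
    simp [abs_of_nonneg (Real.sqrt_nonneg K), Real.sq_sqrt hK.le]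
  have h := integral_circle_comp_hasLaw (P := stdComplexNormal)
    (F := fun θ x => (√K * circleMap 0 1 θ) * x)
    (Measurable.aemeasurable (by unfold circleMap; fun_prop)) hlaw
    (g := fun x => Real.log ‖x - v‖) (by fun_prop) (integrable_log_norm_sub_complexNormal hK v)
  have heq : ∀ x : ℂ, Real.log (max (√K * ‖x‖) ‖v‖) = (2 * Real.pi)⁻¹ *
      ∫ θ in (0)..(2 * Real.pi), Real.log ‖(√K * circleMap 0 1 θ) * x - v‖ := by
    intro x
    have := logMean_C_mul_X_sub_C (√K * x) v
    rw [norm_mul, Complex.norm_real, Real.norm_eq_abs, abs_of_nonneg (Real.sqrt_nonneg K)] at this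
    rw [← this, logMean]
    congr 2 with θ
    simp
    ring_nf
  simp_rw [heq]
  refine ⟨h.1.const_mul _, ?_⟩
  rw [integral_const_mul, h.2, meanLog, inv_mul_cancel_left₀ (by positivity)]

theorem integral_ite_lt_sqrt_mul_norm {K : ℝ} (hK : 0 < K) (v : ℂ) (c : ℝ) :
    Integrable (fun x : ℂ => if ‖v‖ < √K * ‖x‖ then c else 0) stdComplexNormal ∧
    ∫ x : ℂ, (if ‖v‖ < √K * ‖x‖ then c else 0) ∂stdComplexNormal =
      Real.exp (-(‖v‖ ^ 2 / K)) * c := by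
  have hs : 0 < √K := Real.sqrt_pos.2 hK
  have hset : MeasurableSet {x : ℂ | ‖v‖ / √K < ‖x‖} :=
    measurableSet_lt (by fun_prop) (by fun_prop)
  have heq : (fun x : ℂ => if ‖v‖ < √K * ‖x‖ then c else 0) =
      {x : ℂ | ‖v‖ / √K < ‖x‖}.indicator fun _ => c := by
    ext x
    simp [Set.indicator_apply, div_lt_iff₀' hs]
  rw [heq]
  refine ⟨(integrable_const c).indicator hset, ?_⟩
  rw [integral_indicator_const _ hset, measureReal_lt_norm_stdComplexNormal (by positivity),
    div_pow, Real.sq_sqrt hK.le, smul_eq_mul]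

theorem log_sqrt_div {K L : ℝ} (hK : 0 < K) (hL : 0 ≤ L) :
    Real.log (√L / √K) = Real.log (L / K) / 2 := by
  rw [← Real.sqrt_div' _ hK.le, Real.log_sqrt (div_nonneg hL hK.le)]

theorem meanLog_sub_le {K L : ℝ} (hK : 0 < K) (hKL : K ≤ L) (v : ℂ) :
    meanLog L v - meanLog K v ≤ Real.exp (-(‖v‖ ^ 2 / L)) * (Real.log (L / K) / 2) := by
  have hL := hK.trans_le hKL
  obtain ⟨h1, e1⟩ := meanLog_eq_integral_log_max hK v
  obtain ⟨h2, e2⟩ := meanLog_eq_integral_log_max hL v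
  obtain ⟨h3, e3⟩ := integral_ite_lt_sqrt_mul_norm hL v (Real.log (L / K) / 2)
  rw [← e1, ← e2, ← e3, ← integral_sub h2 h1]
  refine integral_mono (h2.sub h1) h3 fun x => ?_
  simp only [← log_sqrt_div hK hL.le]
  exact log_max_mul_sub_log_max_mul_le (Real.sqrt_pos.2 hK) (Real.sqrt_le_sqrt hKL)
    (norm_nonneg _) (norm_nonneg _)

theorem le_meanLog_sub {K L : ℝ} (hK : 0 < K) (hKL : K ≤ L) (v : ℂ) :
    Real.exp (-(‖v‖ ^ 2 / K)) * (Real.log (L / K) / 2) ≤ meanLog L v - meanLog K v := by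
  have hL := hK.trans_le hKL
  obtain ⟨h1, e1⟩ := meanLog_eq_integral_log_max hK v
  obtain ⟨h2, e2⟩ := meanLog_eq_integral_log_max hL v
  obtain ⟨h3, e3⟩ := integral_ite_lt_sqrt_mul_norm hK v (Real.log (L / K) / 2)
  rw [← e1, ← e2, ← e3, ← integral_sub h2 h1]
  refine integral_mono h3 (h2.sub h1) fun x => ?_
  simp only [← log_sqrt_div hK hL.le]
  exact le_log_max_mul_sub_log_max_mul (Real.sqrt_pos.2 hK) (Real.sqrt_le_sqrt hKL)
    (norm_nonneg _) (norm_nonneg _)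

/-! ### The expected number of roots -/

section RandomPoly

variable {Ω : Type*} [MeasurableSpace Ω] {P : Measure Ω} [IsProbabilityMeasure P]
  {η : ℕ → Ω → ℂ} {φ : ℕ → Polynomial ℂ}

theorem integral_logMean_randomPoly (hη_indep : iIndepFun η P)
    (hη_law : ∀ j, HasLaw (η j) stdComplexNormal P) (hφ : ∀ j, φ j = Polynomial.X ^ j)
    (n : ℕ) (v : ℂ) (R : ℝ) :
    Integrable (fun ω => logMean (randomPoly φ n (fun j => η j ω) - Polynomial.C v) R) P ∧
      ∫ ω, logMean (randomPoly φ n (fun j => η j ω) - Polynomial.C v) R ∂P =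
        meanLog (∑ j ∈ Finset.range (n + 1), (R ^ 2) ^ j) v := by
  have hlaw : ∀ θ, HasLaw (fun ω => ∑ j ∈ Finset.range (n + 1), circleMap 0 R θ ^ j * η j ω)
      (complexNormal (∑ j ∈ Finset.range (n + 1), (R ^ 2) ^ j)) P := by
    intro θ
    convert hasLaw_sum_mul hη_indep hη_law (Finset.range (n + 1)) (fun j => circleMap 0 R θ ^ j)
      using 3 with j
    rw [norm_pow, norm_circleMap_zero, pow_right_comm |R|, sq_abs]
  -- The term `j = 0` is `1`, so the variance is positive even at `R = 0`.
  have hpos : 0 < ∑ j ∈ Finset.range (n + 1), (R ^ 2) ^ j := by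
    rw [Finset.sum_range_succ']
    positivity
  have hmeas : AEMeasurable
      (fun q : Ω × ℝ => ∑ j ∈ Finset.range (n + 1), circleMap 0 R q.2 ^ j * η j q.1)
      (P.prod (volume.restrict (Set.Ioc 0 (2 * Real.pi)))) := by
    refine Finset.aemeasurable_fun_sum _ fun j _ => ?_
    refine AEMeasurable.mul (Measurable.aemeasurable (by unfold circleMap; fun_prop)) ?_
    exact (hη_law j).aemeasurable.comp_quasiMeasurePreserving
      Measure.quasiMeasurePreserving_fst
  have h := integral_circle_comp_hasLaw
    (F := fun θ ω => ∑ j ∈ Finset.range (n + 1), circleMap 0 R θ ^ j * η j ω) hmeas hlaw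
    (g := fun x => Real.log ‖x - v‖) (by fun_prop)
    (integrable_log_norm_sub_complexNormal hpos v)
  have heq : ∀ ω, logMean (randomPoly φ n (fun j => η j ω) - Polynomial.C v) R =
      (2 * Real.pi)⁻¹ * ∫ θ in (0)..(2 * Real.pi),
        Real.log ‖∑ j ∈ Finset.range (n + 1), circleMap 0 R θ ^ j * η j ω - v‖ := by
    intro ω
    simp [logMean, randomPoly, hφ, Polynomial.eval_finsetSum, mul_comm (η _ _)]
  simp_rw [heq]
  refine ⟨h.1.const_mul _, ?_⟩
  rw [integral_const_mul, h.2, meanLog, inv_mul_cancel_left₀ (by positivity)]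

theorem integrable_rootCount_randomPoly (hη_indep : iIndepFun η P)
    (hη_law : ∀ j, HasLaw (η j) stdComplexNormal P) (hφ : ∀ j, φ j = Polynomial.X ^ j)
    (n : ℕ) (v : ℂ) {R : ℝ} (hR : 0 < R) :
    Integrable (fun ω =>
      (rootCount (randomPoly φ n (fun j => η j ω)) v (Metric.ball 0 R) : ℝ)) P := by
  refine Integrable.of_bound (C := n) ?_ (ae_of_all _ fun ω => ?_)
  -- Measurability of the count comes from Jensen: it is a pointwise limit of quotients of circle
  -- means.
  · refine aestronglyMeasurable_of_tendsto_ae (𝓝[<] R) (fun r => ?_)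
      (ae_of_all _ fun ω => tendsto_logMean_sub_div _ v hR)
    exact (((integral_logMean_randomPoly hη_indep hη_law hφ n v R).1.sub
      (integral_logMean_randomPoly hη_indep hη_law hφ n v r).1).div_const _).aestronglyMeasurable
  · simpa using rootCount_randomPoly_le hφ n (fun j => η j ω) v (Metric.ball 0 R)

theorem integral_rootCount_mul_log_le (hη_indep : iIndepFun η P)
    (hη_law : ∀ j, HasLaw (η j) stdComplexNormal P) (hφ : ∀ j, φ j = Polynomial.X ^ j)
    (n : ℕ) (v : ℂ) {r R : ℝ} (hr : 0 < r) (hrR : r ≤ R) :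
    (∫ ω, (rootCount (randomPoly φ n (fun j => η j ω)) v (Metric.ball 0 r) : ℝ) ∂P) *
        Real.log (R / r) ≤
      meanLog (∑ j ∈ Finset.range (n + 1), (R ^ 2) ^ j) v
        - meanLog (∑ j ∈ Finset.range (n + 1), (r ^ 2) ^ j) v := by
  obtain ⟨h1, e1⟩ := integral_logMean_randomPoly hη_indep hη_law hφ n v R
  obtain ⟨h2, e2⟩ := integral_logMean_randomPoly hη_indep hη_law hφ n v r
  rw [← e1, ← e2, ← integral_sub h1 h2, ← integral_mul_const]
  exact integral_mono ((integrable_rootCount_randomPoly hη_indep hη_law hφ n v hr).mul_const _)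
    (h1.sub h2) fun ω => rootCount_le_logMean_sub _ v hr hrR

theorem le_integral_rootCount_mul_log (hη_indep : iIndepFun η P)
    (hη_law : ∀ j, HasLaw (η j) stdComplexNormal P) (hφ : ∀ j, φ j = Polynomial.X ^ j)
    (n : ℕ) (v : ℂ) {r R : ℝ} (hr : 0 < r) (hrR : r ≤ R) :
    meanLog (∑ j ∈ Finset.range (n + 1), (R ^ 2) ^ j) v
        - meanLog (∑ j ∈ Finset.range (n + 1), (r ^ 2) ^ j) v ≤
      (∫ ω, (rootCount (randomPoly φ n (fun j => η j ω)) v (Metric.ball 0 R) : ℝ) ∂P) *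
        Real.log (R / r) := by
  obtain ⟨h1, e1⟩ := integral_logMean_randomPoly hη_indep hη_law hφ n v R
  obtain ⟨h2, e2⟩ := integral_logMean_randomPoly hη_indep hη_law hφ n v r
  rw [← e1, ← e2, ← integral_sub h1 h2, ← integral_mul_const]
  exact integral_mono (h1.sub h2)
    ((integrable_rootCount_randomPoly hη_indep hη_law hφ n v (hr.trans_le hrR)).mul_const _)
    fun ω => logMean_sub_le_rootCount _ v hr hrR

/-- The expected number of solutions of `Φ_n = v` in a disc about the origin. -/
theorem integral_rootCount_randomPoly (hη_indep : iIndepFun η P)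
    (hη_law : ∀ j, HasLaw (η j) stdComplexNormal P) (hφ : ∀ j, φ j = Polynomial.X ^ j)
    (n : ℕ) (v : ℂ) {R : ℝ} (hR : 0 < R) :
    ∫ ω, (rootCount (randomPoly φ n (fun j => η j ω)) v (Metric.ball 0 R) : ℝ) ∂P =
      Real.exp (-(‖v‖ ^ 2 / ∑ j ∈ Finset.range (n + 1), (R ^ 2) ^ j)) *
        ((∑ j ∈ Finset.range (n + 1), j * (R ^ 2) ^ j) /
          ∑ j ∈ Finset.range (n + 1), (R ^ 2) ^ j) := by
  set K : ℝ → ℝ := fun s => ∑ j ∈ Finset.range (n + 1), (Real.exp s ^ 2) ^ j with hKdef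
  set E := ∫ ω, (rootCount (randomPoly φ n (fun j => η j ω)) v (Metric.ball 0 R) : ℝ) ∂P
  -- In the variable `s = log R`, division by `log (R / r)` forms the slope of `log K / 2`.
  obtain ⟨s₀, rfl⟩ : ∃ s₀, Real.exp s₀ = R := ⟨Real.log R, Real.exp_log hR⟩
  have hKpos : ∀ s, 0 < K s := fun s => by
    simp only [hKdef, Finset.sum_range_succ' _ n]
    positivity
  have hKmono : ∀ {s t}, s ≤ t → K s ≤ K t := fun h => by
    simp only [hKdef]
    gcongr
  have hK' : HasDerivAt K (2 * ∑ j ∈ Finset.range (n + 1), j * (Real.exp s₀ ^ 2) ^ j) s₀ := by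
    rw [Finset.mul_sum]
    refine HasDerivAt.fun_sum fun j _ => ?_
    have h : HasDerivAt (fun s => Real.exp (2 * j * s)) (Real.exp (2 * j * s₀) * (2 * j)) s₀ := by
      simpa using ((hasDerivAt_id s₀).const_mul (2 * (j : ℝ))).exp
    have heq : ∀ s : ℝ, (Real.exp s ^ 2) ^ j = Real.exp (2 * j * s) := by
      intro s
      rw [← pow_mul, ← Real.exp_nat_mul]
      push_cast
      rfl
    simp_rw [heq]
    exact h.congr_deriv (by ring)
  have hlog : HasDerivAt (fun s => Real.log (K s) / 2)
      ((∑ j ∈ Finset.range (n + 1), j * (Real.exp s₀ ^ 2) ^ j) / K s₀) s₀ :=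
    ((hK'.log (hKpos s₀).ne').div_const 2).congr_deriv (by ring)
  have hlim : Tendsto (fun s => Real.exp (-(‖v‖ ^ 2 / K s)) *
      slope (fun s => Real.log (K s) / 2) s₀ s) (𝓝[≠] s₀)
      (𝓝 (Real.exp (-(‖v‖ ^ 2 / K s₀)) *
        ((∑ j ∈ Finset.range (n + 1), j * (Real.exp s₀ ^ 2) ^ j) / K s₀))) := by
    refine Tendsto.mul ?_ (hasDerivAt_iff_tendsto_slope.1 hlog)
    have hc : ContinuousAt (fun s => Real.exp (-(‖v‖ ^ 2 / K s))) s₀ :=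
      (continuousAt_const.div hK'.continuousAt (hKpos s₀).ne').neg.rexp
    exact hc.tendsto.mono_left nhdsWithin_le_nhds
  have hdiv : ∀ s t : ℝ, Real.log (Real.exp s / Real.exp t) = s - t := fun s t => by
    rw [← Real.exp_sub, Real.log_exp]
  refine le_antisymm ?_ ?_
  -- Larger radii bound the count at `s₀` from above; smaller radii, in the other case, from below.
  · refine ge_of_tendsto (hlim.mono_left (nhdsGT_le_nhdsNE s₀)) ?_
    filter_upwards [self_mem_nhdsWithin] with s (hs : s₀ < s)
    have h := (integral_rootCount_mul_log_le hη_indep hη_law hφ n v hR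
      (Real.exp_le_exp.2 hs.le)).trans (meanLog_sub_le (hKpos s₀) (hKmono hs.le) v)
    rw [hdiv, Real.log_div (hKpos s).ne' (hKpos s₀).ne', ← le_div_iff₀ (sub_pos.2 hs)] at h
    refine h.trans (le_of_eq ?_)
    rw [slope_def_field]
    ring
  · refine le_of_tendsto (hlim.mono_left (nhdsLT_le_nhdsNE s₀)) ?_
    filter_upwards [self_mem_nhdsWithin] with s (hs : s < s₀)
    have h := (le_meanLog_sub (hKpos s) (hKmono hs.le) v).trans
      (le_integral_rootCount_mul_log hη_indep hη_law hφ n v (Real.exp_pos s)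
        (Real.exp_le_exp.2 hs.le))
    rw [hdiv, Real.log_div (hKpos s₀).ne' (hKpos s).ne', ← div_le_iff₀ (sub_pos.2 hs)] at h
    refine (le_of_eq ?_).trans h
    rw [slope_comm, slope_def_field]
    ring

end RandomPoly

/-! ### Geometric series and their derivatives -/

theorem tendsto_sum_geometric {x : ℝ} (hx0 : 0 ≤ x) (hx : x < 1) :
    Tendsto (fun n : ℕ => ∑ j ∈ Finset.range (n + 1), x ^ j) atTop (𝓝 (1 / (1 - x))) := by
  rw [one_div]
  exact (hasSum_geometric_of_lt_one hx0 hx).tendsto_sum_nat.comp (tendsto_add_atTop_nat 1)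

theorem tendsto_sum_mul_geometric {x : ℝ} (hx0 : 0 ≤ x) (hx : x < 1) :
    Tendsto (fun n : ℕ => ∑ j ∈ Finset.range (n + 1), j * x ^ j) atTop
      (𝓝 (x / (1 - x) ^ 2)) :=
  (hasSum_coe_mul_geometric_of_norm_lt_one
    (by rwa [Real.norm_of_nonneg hx0])).tendsto_sum_nat.comp (tendsto_add_atTop_nat 1)

theorem tendsto_sum_mul_pow_pred {x : ℝ} (hx0 : 0 ≤ x) (hx : x < 1) :
    Tendsto (fun n : ℕ => ∑ j ∈ Finset.range (n + 1), j * x ^ (j - 1)) atTop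
      (𝓝 (1 / (1 - x) ^ 2)) := by
  have h := (hasSum_choose_mul_geometric_of_norm_lt_one 1
    (show ‖x‖ < 1 by rwa [Real.norm_of_nonneg hx0])).tendsto_sum_nat
  refine h.congr fun n => ?_
  rw [Finset.sum_range_succ']
  simp

theorem tendsto_sum_sq_mul_pow_pred {x : ℝ} (hx0 : 0 ≤ x) (hx : x < 1) :
    Tendsto (fun n : ℕ => ∑ j ∈ Finset.range (n + 1), (j : ℝ) ^ 2 * x ^ (j - 1)) atTop
      (𝓝 ((1 + x) / (1 - x) ^ 3)) := by
  have hx' : ‖x‖ < 1 := by rwa [Real.norm_of_nonneg hx0]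
  -- After shifting the index, `(j + 1) ^ 2 = 2 * (j + 2).choose 2 - (j + 1)`.
  have h := (((hasSum_choose_mul_geometric_of_norm_lt_one 2 hx').mul_left 2).sub
    (hasSum_choose_mul_geometric_of_norm_lt_one 1 hx')).tendsto_sum_nat
  have hval : 2 * (1 / (1 - x) ^ (2 + 1)) - 1 / (1 - x) ^ (1 + 1) = (1 + x) / (1 - x) ^ 3 := by
    have : 1 - x ≠ 0 := (sub_pos.2 hx).ne'
    field_simp
    ring
  rw [hval] at h
  refine h.congr fun n => ?_
  rw [Finset.sum_range_succ']
  simp only [Nat.cast_zero, ne_eq, OfNat.ofNat_ne_zero, not_false_eq_true, zero_pow, zero_mul,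
    add_zero]
  refine Finset.sum_congr rfl fun j _ => ?_
  rw [Nat.cast_choose_two]
  push_cast
  simp
  ring

/-! ### Kernels of the monomials and the limiting density -/

section Kernel

variable {φ : ℕ → Polynomial ℂ}

theorem kernel_zero_zero_re (hφ : ∀ j, φ j = Polynomial.X ^ j) (n : ℕ) (z : ℂ) :
    (kernel φ n 0 0 z z).re = ∑ j ∈ Finset.range (n + 1), (‖z‖ ^ 2) ^ j := by
  have h : kernel φ n 0 0 z z = ((∑ j ∈ Finset.range (n + 1), (‖z‖ ^ 2) ^ j : ℝ) : ℂ) := by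
    simp [kernel, hφ, ← mul_pow, Complex.mul_conj']
  rw [h, Complex.ofReal_re]

theorem norm_kernel_zero_one (hφ : ∀ j, φ j = Polynomial.X ^ j) (n : ℕ) (z : ℂ) :
    ‖kernel φ n 0 1 z z‖ =
      ‖z‖ * ∑ j ∈ Finset.range (n + 1), j * (‖z‖ ^ 2) ^ (j - 1) := by
  have h : kernel φ n 0 1 z z =
      z * ((∑ j ∈ Finset.range (n + 1), j * (‖z‖ ^ 2) ^ (j - 1) : ℝ) : ℂ) := by
    push_cast
    rw [kernel, Finset.mul_sum]
    refine Finset.sum_congr rfl fun j _ => ?_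
    rcases j with _ | j
    · simp [hφ]
    · simp [hφ, ← Complex.mul_conj', mul_pow]
      ring
  rw [h, norm_mul, Complex.norm_real, Real.norm_of_nonneg (by positivity)]

theorem kernel_one_one_re (hφ : ∀ j, φ j = Polynomial.X ^ j) (n : ℕ) (z : ℂ) :
    (kernel φ n 1 1 z z).re =
      ∑ j ∈ Finset.range (n + 1), (j : ℝ) ^ 2 * (‖z‖ ^ 2) ^ (j - 1) := by
  have h : kernel φ n 1 1 z z =
      ((∑ j ∈ Finset.range (n + 1), (j : ℝ) ^ 2 * (‖z‖ ^ 2) ^ (j - 1) : ℝ) : ℂ) := by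
    push_cast
    refine Finset.sum_congr rfl fun j _ => ?_
    simp [hφ, ← Complex.mul_conj', mul_pow, Polynomial.derivative_X_pow]
    ring
  rw [h, Complex.ofReal_re]

/-- With `x = ‖z‖ ^ 2`, the limits of `K`, `|K⁰¹|²` and `K¹¹` are `1 / (1 - x)`, `x / (1 - x) ^ 4`
and `(1 + x) / (1 - x) ^ 3`. The part of the bracket free of `v` collapses because `(1 + x) - x =
1`. -/
theorem tendsto_density (hφ : ∀ j, φ j = Polynomial.X ^ j) (v : ℂ) {z : ℂ} (hz : ‖z‖ < 1) :
    Tendsto (fun n => density φ n v z) atTop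
      (𝓝 (1 / Real.pi * (1 / (1 - ‖z‖ ^ 2) ^ 2 + ‖v * z‖ ^ 2 / (1 - ‖z‖ ^ 2)) *
        Real.exp (-(‖v‖ ^ 2 * (1 - ‖z‖ ^ 2))))) := by
  have hx0 : 0 ≤ ‖z‖ ^ 2 := by positivity
  have hx : ‖z‖ ^ 2 < 1 := pow_lt_one₀ (norm_nonneg z) hz two_ne_zero
  have hne : 1 - ‖z‖ ^ 2 ≠ 0 := (sub_pos.2 hx).ne'
  have hK : 1 / (1 - ‖z‖ ^ 2) ≠ 0 := one_div_ne_zero hne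
  have h0 := tendsto_sum_geometric hx0 hx
  have h1 := (tendsto_sum_mul_pow_pred hx0 hx).const_mul ‖z‖
  have h2 := tendsto_sum_sq_mul_pow_pred hx0 hx
  have hv := (tendsto_const_nhds (x := ‖v‖ ^ 2)).div h0 hK
  have h := (((h2.div h0 hK).sub (((h1.pow 2).div (h0.pow 2) (pow_ne_zero 2 hK)).mul
    (hv.const_sub 1))).const_mul (1 / Real.pi)).mul
    ((Real.continuous_exp.tendsto _).comp hv.neg)
  simp only [density, kernel_zero_zero_re hφ, norm_kernel_zero_one hφ, kernel_one_one_re hφ]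
  refine h.trans (le_of_eq (congrArg _ ?_))
  congr 2
  · rw [norm_mul]
    field_simp
    ring
  · rw [div_div_eq_mul_div, div_one]

end Kernel

end RandomPolynomial

theorem corollary6p2 {Ω : Type*} [MeasurableSpace Ω] (P : Measure Ω) [IsProbabilityMeasure P]
    (η : ℕ → Ω → ℂ) (hη_indep : iIndepFun η P)
    (hη_law : ∀ j, HasLaw (η j) RandomPolynomial.stdComplexNormal P)
    (φ : ℕ → Polynomial ℂ) (hφ : ∀ j, φ j = Polynomial.X ^ j)
    (v : ℂ) (ϱ : ℝ) (hϱ_pos : 0 < ϱ) (hϱ_lt : ϱ < 1) :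
    (∀ n : ℕ, Integrable (fun ω => (RandomPolynomial.rootCount
        (RandomPolynomial.randomPoly φ n (fun j => η j ω)) v (Metric.ball 0 ϱ) : ℝ)) P) ∧
    Tendsto (fun n : ℕ => ∫ ω, (RandomPolynomial.rootCount
        (RandomPolynomial.randomPoly φ n (fun j => η j ω)) v (Metric.ball 0 ϱ) : ℝ) ∂P)
      atTop
      (𝓝 (ϱ ^ 2 / (1 - ϱ ^ 2) * Real.exp (-(‖v‖ ^ 2 * (1 - ϱ ^ 2))))) ∧
    ∀ z : ℂ, ‖z‖ < 1 →
      Tendsto (fun n : ℕ => RandomPolynomial.density φ n v z /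
          ∫ ω, (RandomPolynomial.rootCount
            (RandomPolynomial.randomPoly φ n (fun j => η j ω)) v (Metric.ball 0 ϱ) : ℝ) ∂P)
        atTop
        (𝓝 ((1 - ϱ ^ 2) / (Real.pi * ϱ ^ 2) *
          (1 / (1 - ‖z‖ ^ 2) ^ 2 + ‖v * z‖ ^ 2 / (1 - ‖z‖ ^ 2)) *
          Real.exp (‖v‖ ^ 2 * (‖z‖ ^ 2 - ϱ ^ 2)))) := by
  have hx0 : 0 ≤ ϱ ^ 2 := by positivity
  have hx : ϱ ^ 2 < 1 := pow_lt_one₀ hϱ_pos.le hϱ_lt two_ne_zero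
  have hne : 1 - ϱ ^ 2 ≠ 0 := (sub_pos.2 hx).ne'
  have hK : 1 / (1 - ϱ ^ 2) ≠ 0 := one_div_ne_zero hne
  have hlim : Tendsto (fun n : ℕ => ∫ ω, (RandomPolynomial.rootCount
      (RandomPolynomial.randomPoly φ n (fun j => η j ω)) v (Metric.ball 0 ϱ) : ℝ) ∂P) atTop
      (𝓝 (ϱ ^ 2 / (1 - ϱ ^ 2) * Real.exp (-(‖v‖ ^ 2 * (1 - ϱ ^ 2))))) := by
    have h0 := RandomPolynomial.tendsto_sum_geometric hx0 hx
    have h := ((Real.continuous_exp.tendsto _).comp (Tendsto.div (tendsto_const_nhds (x := ‖v‖ ^ 2)) h0 hK).neg).mul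
      ((RandomPolynomial.tendsto_sum_mul_geometric hx0 hx).div h0 hK)
    simp only [RandomPolynomial.integral_rootCount_randomPoly hη_indep hη_law hφ _ v hϱ_pos]
    refine h.trans (le_of_eq (congrArg _ ?_))
    rw [div_div_eq_mul_div (‖v‖ ^ 2), div_one, mul_comm]
    congr 1
    field_simp
  refine ⟨fun n => RandomPolynomial.integrable_rootCount_randomPoly hη_indep hη_law hφ n v hϱ_pos,
    hlim, fun z hz => ?_⟩
  -- A nonzero limit of the expected counts permits dividing the two limits.
  have hpos : 0 < ϱ ^ 2 / (1 - ϱ ^ 2) * Real.exp (-(‖v‖ ^ 2 * (1 - ϱ ^ 2))) :=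
    mul_pos (div_pos (by positivity) (sub_pos.2 hx)) (Real.exp_pos _)
  refine ((RandomPolynomial.tendsto_density hφ v hz).div hlim hpos.ne').trans (le_of_eq (congrArg _ ?_))
  have hexp : Real.exp (‖v‖ ^ 2 * (‖z‖ ^ 2 - ϱ ^ 2)) =
      Real.exp (-(‖v‖ ^ 2 * (1 - ‖z‖ ^ 2))) / Real.exp (-(‖v‖ ^ 2 * (1 - ϱ ^ 2))) := by
    rw [← Real.exp_sub]
    ring_nf
  rw [hexp]
  generalize 1 / (1 - ‖z‖ ^ 2) ^ 2 + ‖v * z‖ ^ 2 / (1 - ‖z‖ ^ 2) = A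
  field_simp
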